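/- Theorem (routing in $G_9$ and $G_{12}$). Let $P$ be a finite set of $n$ points in the plane, no two of which lie on a line parallel to a direction $k\pi/3$ ($k\in\mathbb{Z}$). For $u\in P$ divide the plane around $u$ into six cones by the rays from $u$ at angles $k\pi/3$, and call them, counter-clockwise from the positive $x$-axis, $\overline C_1,C_0,\overline C_2,C_1,\overline C_0,C_2$; the cones $C_i$ are positive, the cones $\overline C_i$ negative. The half-$\theta_6$-graph of $P$ joins each $u\in P$, in each of its positive cones that contains a point of $P$, to the closest vertex in that cone; "closest" always means that the projection on the bisector of the cone is closest to $u$. The graph $G_{12}$ keeps, of the edges of the half-$\theta_6$-graph from $u$ into each negative cone of $u$, only the first and the last in clockwise order around $u$ and the one to the closest neighbour. The graph $G_9$ consists of the edges to the closest neighbour in each negative cone of each vertex and of the edges between clockwise consecutive neighbours (in the half-$\theta_6$-graph) of a vertex within one of its negative cones. A unit of memory holds an integer in $\{0,\dots,n-1\}$ or a point of $P$. In a deterministic $1$-local $m$-memory routing algorithm with information stored at the vertices, the vertex to which a message is forwarded and its new memory of at most $m$ units are a function of the current vertex $s$, the destination $t$, the set consisting of $s$ and its neighbours, the information stored at $s$,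 and the present memory of the message, which is empty at the start; the message is always forwarded to a neighbour of $s$. There are a constant $m$ and one such routing algorithm, both independent of $P$, such that for every $P$ as above one can store at most $m$ units of information at each vertex so that, on $G_9$ as well as on $G_{12}$, for all $s,t \in P$ the message from $s$ reaches $t$ after travelling a total distance of at most 1. $6\,|st|$ if $t$ lies in a positive cone of $s$, 2. $3\cdot\frac{5}{\sqrt3}\,|st|\approx 8.660\,|st|$ if $t$ lies in a negative cone of $s$. -/

import Mathlib

noncomputable section

/-! ### Cones in the plane -/

/-- The Euclidean plane. -/
abbrev Plane : Type := EuclideanSpace ℝ (Fin 2)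

/-- Unit vector in the direction that makes the angle `θ` with the positive `x`-axis. -/
def dir (θ : ℝ) : Plane := !₂[Real.cos θ, Real.sin θ]

/-- The direction of the `k`-th cone boundary ray: angle `k * π / 3`. -/
def ray (k : ℕ) : Plane := dir (k * (Real.pi / 3))

/-- The open cone with apex `u` between the rays at angles `k * π / 3` and `(k + 1) * π / 3`. -/
def sector (k : ℕ) (u : Plane) : Set Plane :=
  {v | ∃ a b : ℝ, 0 < a ∧ 0 < b ∧ v = u + a • ray k + b • ray (k + 1)}

/-- Signed length of the projection of `v - u` on the bisector of the `k`-th cone of `u`. -/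
def bisectorProj (k : ℕ) (u v : Plane) : ℝ :=
  inner ℝ (dir ((2 * k + 1) * (Real.pi / 6))) (v - u)

/-- The number of the sector that is the positive cone `C i`: counter-clockwise from the
positive `x`-axis the six cones are `C̄ 1, C 0, C̄ 2, C 1, C̄ 0, C 2`. -/
def posIndex (i : Fin 3) : ℕ := 2 * i + 1

/-- The number (modulo 6) of the sector that is the negative cone `C̄ i`, opposite to `C i`. -/
def negIndex (i : Fin 3) : ℕ := 2 * i + 4

/-- The positive cone `C i` with apex `u`. -/
def posCone (i : Fin 3) (u : Plane) : Set Plane := sector (posIndex i) u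

/-- The negative cone `C̄ i` with apex `u`. -/
def negCone (i : Fin 3) (u : Plane) : Set Plane := sector (negIndex i) u

/-- No two points of `P` lie on a line parallel to a cone boundary. -/
def GeneralPosition (P : Finset Plane) : Prop :=
  ∀ u ∈ P, ∀ v ∈ P, u ≠ v → ∀ (k : ℕ) (c : ℝ), v - u ≠ c • ray k

/-! ### The half-θ₆-graph and its bounded degree subgraphs -/

/-- `v` is the closest vertex of `P` in the positive cone `C i` of `u`, where distances are
measured along the bisector of the cone. -/
def IsClosestPos (P : Finset Plane) (i : Fin 3) (u v : P) : Prop :=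
  (v : Plane) ∈ posCone i u ∧
    ∀ w : P, (w : Plane) ∈ posCone i u →
      bisectorProj (posIndex i) u v ≤ bisectorProj (posIndex i) u w

/-- The half-θ₆-graph of `P`: every vertex is joined to the closest vertex in each of its
positive cones. -/
def halfTheta6 (P : Finset Plane) : SimpleGraph P :=
  SimpleGraph.fromRel fun u v => ∃ i, IsClosestPos P i u v

/-- The neighbours of `u` in the half-θ₆-graph that lie in the negative cone `C̄ i` of `u`. -/
def negNbrs (P : Finset Plane) (i : Fin 3) (u : P) : Set P :=
  {v | (halfTheta6 P).Adj u v ∧ (v : Plane) ∈ negCone i u}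

/-- For `v`, `w` in a common cone of `u`: `w` comes strictly after `v` in clockwise order
around `u`. -/
def ClockwiseLT (u v w : Plane) : Prop :=
  (v - u) 0 * (w - u) 1 - (v - u) 1 * (w - u) 0 < 0

/-- `v` is the neighbour of `u` in the negative cone `C̄ i` that is closest along the bisector. -/
def IsClosestNeg (P : Finset Plane) (i : Fin 3) (u v : P) : Prop :=
  v ∈ negNbrs P i u ∧
    ∀ w ∈ negNbrs P i u, bisectorProj (negIndex i) u v ≤ bisectorProj (negIndex i) u w

/-- `v` is the first neighbour of `u` in the negative cone `C̄ i`, in clockwise order. -/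
def IsFirstNeg (P : Finset Plane) (i : Fin 3) (u v : P) : Prop :=
  v ∈ negNbrs P i u ∧ ∀ w ∈ negNbrs P i u, w ≠ v → ClockwiseLT u v w

/-- `v` is the last neighbour of `u` in the negative cone `C̄ i`, in clockwise order. -/
def IsLastNeg (P : Finset Plane) (i : Fin 3) (u v : P) : Prop :=
  v ∈ negNbrs P i u ∧ ∀ w ∈ negNbrs P i u, w ≠ v → ClockwiseLT u w v

/-- `v` and `w` are consecutive neighbours of `u` (in this clockwise order) in the negative
cone `C̄ i`, so that `v w` is an edge of the canonical path of `u` in this cone. -/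
def IsConsecutiveNeg (P : Finset Plane) (i : Fin 3) (u v w : P) : Prop :=
  v ∈ negNbrs P i u ∧ w ∈ negNbrs P i u ∧ ClockwiseLT u v w ∧
    ∀ x ∈ negNbrs P i u, ¬ (ClockwiseLT u v x ∧ ClockwiseLT u x w)

/-- `G₁₂`: of the edges in each negative cone, only the first, the last and the closest are
kept. -/
def G12 (P : Finset Plane) : SimpleGraph P :=
  SimpleGraph.fromRel fun u v =>
    ∃ i, IsFirstNeg P i u v ∨ IsLastNeg P i u v ∨ IsClosestNeg P i u v

/-- `G₉`: the edges of the half-θ₆-graph that are the closest edge in some negative cone or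
belong to the canonical path of some negative cone. -/
def G9 (P : Finset Plane) : SimpleGraph P :=
  SimpleGraph.fromRel fun v w =>
    (halfTheta6 P).Adj v w ∧
      ((∃ i, IsClosestNeg P i v w) ∨ ∃ i u, IsConsecutiveNeg P i u v w)

/-! ### Local routing with memory -/

/-- The content of a unit of memory: an integer or a point. -/
inductive MemCell : Type
  | int (k : ℕ)
  | pt (p : Plane)

/-- The contents allowed when the vertex set is `P`, with `n` elements: an integer of `log₂ n`
bits, or a vertex. (Points outside `P` are not allowed: arbitrary real coordinates could encode
the whole graph in a single unit.) -/
def MemCell.Valid (P : Finset Plane) : MemCell → Prop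
  | .int k => k < P.card
  | .pt p => p ∈ P

/-- The list `M` of memory contents takes at most `m` units of memory. -/
def FitsMemory (P : Finset Plane) (m : ℕ) (M : List MemCell) : Prop :=
  M.length ≤ m ∧ ∀ c ∈ M, c.Valid P

/-- The `k`-neighbourhood of `s`: the vertices, as points of the plane, that can be reached
from `s` along at most `k` edges. -/
def kNeighborhood {P : Finset Plane} (G : SimpleGraph P) (k : ℕ) (s : P) : Set Plane :=
  {q | ∃ v : P, (v : Plane) = q ∧ ∃ p : G.Walk s v, p.length ≤ k}

/-- A deterministic local routing algorithm. From the current vertex `s`, the destination `t`,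
the neighbourhood of `s`, the extra information stored at `s` and the memory carried by the
message, it computes the vertex to which the message is forwarded and the new memory. It knows
nothing else about the graph. -/
structure RoutingAlgorithm : Type where
  next : (s t : Plane) → (nbhd : Set Plane) → (info mem : List MemCell) → Plane × List MemCell

/-- `A.Route G k m info t s M L`: in the graph `G`, with `k`-neighbourhoods known and `info v`
stored at each vertex `v`, a message for `t` that is at `s` with memory contents `M` is routed
by `A` along edges of `G` to `t`, it never carries more than `m` units of memory, and it
travels the total distance `L`. -/
inductive RoutingAlgorithm.Route (A : RoutingAlgorithm) {P : Finset Plane}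
    (G : SimpleGraph P) (k m : ℕ) (info : P → List MemCell) (t : P) :
    P → List MemCell → ℝ → Prop
  | arrived (M : List MemCell) : A.Route G k m info t t M 0
  | forward (s v : P) (M M' : List MemCell) (L : ℝ) :
      s ≠ t →
      A.next s t (kNeighborhood G k s) (info s) M = ((v : Plane), M') →
      G.Adj s v →
      FitsMemory P m M' →
      A.Route G k m info t v M' L →
      A.Route G k m info t s M (dist (s : Plane) v + L)

/-- `A`, started with empty memory, is a `k`-local `m`-memory routing algorithm on `G` that is
`d`-competitive for all sources `s` and destinations `t` that satisfy `R s t`: the message is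
delivered and travels at most `d` times the Euclidean distance of `s` and `t`. -/
def RoutingAlgorithm.IsCompetitive (A : RoutingAlgorithm) {P : Finset Plane}
    (G : SimpleGraph P) (k m : ℕ) (info : P → List MemCell)
    (R : Plane → Plane → Prop) (d : ℝ) : Prop :=
  ∀ s t : P, R s t →
    ∃ L : ℝ, A.Route G k m info t s [] L ∧ L ≤ d * dist (s : Plane) t

/-- `t` lies in a positive cone of `s`. -/
def InPosCone (s t : Plane) : Prop := ∃ i, t ∈ posCone i s

/-- `t` lies in a negative cone of `s`. -/
def InNegCone (s t : Plane) : Prop := ∃ i, t ∈ negCone i s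

end

/-! Differences in two hexagonal coordinates are oblique coordinates, so cones and lengths become
linear arithmetic. The route is planned in the half-θ₆-graph, whose edges join vertices to their
parents. G₉ and G₁₂ may lack such an edge, but both keep the edges to closest children and between
consecutive siblings (`hasRoutingEdges`), because the triangle of a vertex and two consecutive
children is empty. A planned edge is replaced by the path along the siblings and through the closest
child. If the edge has coordinate differences x, y > 0, this path has length at most 3 max(x, y) +
min(x, y) (`reaches_up`, `reaches_child`).

A potential pays for the paths. For t in the negative cone C̄ i of s let p, q > 0 be the differences
of t and s in the coordinates j, k. The potential is 2(p+q) + min(p, q), and only (p+q) + p if the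
side k is free, that is, if C k of s has no vertex in the triangle of t and s. A step leads to a
child of s in the parallelogram of s and t if there is one, and otherwise to the parent in an
occupied side, the shorter one if both are occupied. Three times the drop of the potential covers
the path, and a free side stays free (`reaches_neg`).

For t in a positive cone the potential is p+q + max(p, q), with p, q the absolute differences, and a
step leads to the parent. If t then lies in a negative cone, one side is free and the smaller bound
for negative cones applies (`reaches_pos`). The potentials are at most 2|st| and (5/√3)|st|. The
stored points make every decision local; the memory only tells which edge is being replaced. -/

noncomputable section

/-! ### Hexagonal coordinates -/

/-- The hexagonal coordinates of a point: the signed lengths of its projections on the bisectors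
of the positive cones, scaled so that the cone boundary rays have coordinates in `{-1, 0, 1}`. -/
def hex (i : Fin 3) (v : Plane) : ℝ := 2 / √3 * bisectorProj (posIndex i) 0 v

lemma sqrt_three_sq : √3 * √3 = (3 : ℝ) := Real.mul_self_sqrt (by norm_num)

lemma sqrt_three_pos : 0 < √(3 : ℝ) := Real.sqrt_pos.2 (by norm_num)

lemma dir_add_pi (θ : ℝ) : dir (θ + Real.pi) = -dir θ := by
  ext i; fin_cases i <;> simp [dir]

lemma dir_pi_div_two : dir (Real.pi / 2) = !₂[0, 1] := by
  simp [dir]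

lemma dir_pi_div_six : dir (Real.pi / 6) = !₂[√3 / 2, 1 / 2] := by
  simp [dir]

lemma dir_five_pi_div_six : dir (5 * Real.pi / 6) = !₂[-(√3 / 2), 1 / 2] := by
  have h : 5 * Real.pi / 6 = Real.pi - Real.pi / 6 := by ring
  simp [dir, h]

lemma inner_vec (a b : ℝ) (v : Plane) : inner ℝ (!₂[a, b] : Plane) v = a * v 0 + b * v 1 := by
  simp [PiLp.inner_apply, Fin.sum_univ_two, mul_comm]

lemma inv_sqrt_three : (√3)⁻¹ = √3 / 3 := by
  have := sqrt_three_pos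
  have := sqrt_three_sq
  field_simp
  nlinarith

lemma hex_zero (v : Plane) : hex 0 v = 2 * √3 / 3 * v 1 := by
  have h : ((2 * (posIndex 0 : ℕ) + 1) * (Real.pi / 6) : ℝ) = Real.pi / 2 := by
    simp [posIndex]; ring
  rw [hex, bisectorProj, h, dir_pi_div_two, inner_vec, div_eq_mul_inv, inv_sqrt_three,
    sub_zero]
  ring

lemma hex_one (v : Plane) : hex 1 v = -v 0 - √3 / 3 * v 1 := by
  have h : ((2 * (posIndex 1 : ℕ) + 1) * (Real.pi / 6) : ℝ) = Real.pi / 6 + Real.pi := by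
    simp [posIndex]; ring
  rw [hex, bisectorProj, h, dir_add_pi, dir_pi_div_six, inner_neg_left, inner_vec, div_eq_mul_inv,
    inv_sqrt_three]
  simp
  linear_combination (-v 0 / 3) * sqrt_three_sq

lemma hex_two (v : Plane) : hex 2 v = v 0 - √3 / 3 * v 1 := by
  have h : ((2 * (posIndex 2 : ℕ) + 1) * (Real.pi / 6) : ℝ) = 5 * Real.pi / 6 + Real.pi := by
    simp [posIndex]; ring
  rw [hex, bisectorProj, h, dir_add_pi, dir_five_pi_div_six, inner_neg_left, inner_vec,
    div_eq_mul_inv, inv_sqrt_three]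
  simp
  linear_combination (v 0 / 3) * sqrt_three_sq

lemma hex_sub (i : Fin 3) (v w : Plane) : hex i (v - w) = hex i v - hex i w := by
  simp [hex, bisectorProj, inner_sub_right]; ring

lemma hex_add (i : Fin 3) (v w : Plane) : hex i (v + w) = hex i v + hex i w := by
  simp [hex, bisectorProj, inner_add_right]; ring

lemma hex_smul (i : Fin 3) (c : ℝ) (v : Plane) : hex i (c • v) = c * hex i v := by
  simp [hex, bisectorProj, inner_smul_right]; ring

lemma bisectorProj_pos (i : Fin 3) (u v : Plane) :
    bisectorProj (posIndex i) u v = √3 / 2 * (hex i v - hex i u) := by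
  rw [← hex_sub, hex]
  have := sqrt_three_pos
  simp [bisectorProj]
  field_simp

lemma bisectorProj_neg (i : Fin 3) (u v : Plane) :
    bisectorProj (negIndex i) u v = √3 / 2 * (hex i u - hex i v) := by
  have h : ((2 * (negIndex i : ℕ) + 1) * (Real.pi / 6) : ℝ)
      = (2 * (posIndex i : ℕ) + 1) * (Real.pi / 6) + Real.pi := by
    simp [negIndex, posIndex]; ring
  have h2 := bisectorProj_pos i u v
  rw [bisectorProj] at h2 ⊢
  rw [h, dir_add_pi, inner_neg_left, h2]
  ring

lemma hex_sum (v : Plane) : hex 0 v + hex 1 v + hex 2 v = 0 := by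
  rw [hex_zero, hex_one, hex_two]; ring

lemma plane_ext {v w : Plane} (h0 : hex 0 v = hex 0 w) (h1 : hex 1 v = hex 1 w) : v = w := by
  rw [hex_zero, hex_zero] at h0
  have h3 := sqrt_three_pos
  have e : v 1 = w 1 := mul_left_cancel₀ (by positivity) h0
  rw [hex_one, hex_one, e] at h1
  ext i
  fin_cases i
  · simpa using h1
  · exact e

lemma ray_add_three (k : ℕ) : ray (k + 3) = -ray k := by
  rw [ray, ray, ← dir_add_pi]
  congr 1; push_cast; ring

lemma ray_zero : ray 0 = !₂[1, 0] := by simp [ray, dir]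

lemma ray_one : ray 1 = !₂[1 / 2, √3 / 2] := by simp [ray, dir]

lemma ray_two : ray 2 = !₂[-(1 / 2), √3 / 2] := by
  have h : ((2 : ℕ) : ℝ) * (Real.pi / 3) = Real.pi - Real.pi / 3 := by push_cast; ring
  simp only [ray, dir, h]
  simp

lemma hex_neg (i : Fin 3) (v : Plane) : hex i (-v) = -hex i v := by
  simp [hex, bisectorProj]

lemma hex_ray_zero : hex 0 (ray 0) = 0 ∧ hex 1 (ray 0) = -1 ∧ hex 2 (ray 0) = 1 := by
  simp [hex_zero, hex_one, hex_two, ray_zero]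

lemma hex_ray_one : hex 0 (ray 1) = 1 ∧ hex 1 (ray 1) = -1 ∧ hex 2 (ray 1) = 0 := by
  simp only [hex_zero, hex_one, hex_two, ray_one]
  simp
  refine ⟨?_, ?_, ?_⟩
  · linear_combination (1/3) * sqrt_three_sq
  · linear_combination (-1/6) * sqrt_three_sq
  · linear_combination (-1/6) * sqrt_three_sq

lemma hex_ray_two : hex 0 (ray 2) = 1 ∧ hex 1 (ray 2) = 0 ∧ hex 2 (ray 2) = -1 := by
  simp only [hex_zero, hex_one, hex_two, ray_two]
  simp
  refine ⟨?_, ?_, ?_⟩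
  · linear_combination (1/3) * sqrt_three_sq
  · linear_combination (-1/6) * sqrt_three_sq
  · linear_combination (-1/6) * sqrt_three_sq

/-- The three indices are distinct. -/
def Distinct (i j k : Fin 3) : Prop := i ≠ j ∧ i ≠ k ∧ j ≠ k

lemma Distinct.swap {i j k : Fin 3} (h : Distinct i j k) : Distinct i k j :=
  ⟨h.2.1, h.1, h.2.2.symm⟩

lemma Distinct.rotate {i j k : Fin 3} (h : Distinct i j k) : Distinct j k i :=
  ⟨h.2.2, h.1.symm, h.2.1.symm⟩

lemma Distinct.eq_or {i j k : Fin 3} (h : Distinct i j k) (l : Fin 3) :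
    l = i ∨ l = j ∨ l = k := by
  revert i j k l
  unfold Distinct
  decide

lemma Distinct.hex_sum {i j k : Fin 3} (h : Distinct i j k) (v : Plane) :
    hex i v + hex j v + hex k v = 0 := by
  have := _root_.hex_sum v
  obtain ⟨h1, h2, h3⟩ := h
  fin_cases i <;> fin_cases j <;> fin_cases k <;> simp_all <;> linarith

/-- `v` lies in the positive cone `C i` of `u`, in hexagonal coordinates. -/
def Cone (i : Fin 3) (u v : Plane) : Prop := ∀ j, j ≠ i → hex j v < hex j u

lemma Distinct.cone_iff {i j k : Fin 3} (h : Distinct i j k) {u v : Plane} :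
    Cone i u v ↔ hex j v < hex j u ∧ hex k v < hex k u := by
  constructor
  · intro H
    exact ⟨H j h.1.symm, H k h.2.1.symm⟩
  · rintro ⟨a, b⟩ l hl
    rcases (h.eq_or l).resolve_left hl with rfl | rfl <;> assumption

/-- The cone spanned by `r` and `s` with hexagonal coordinates of `r`, `s` known. -/
lemma exists_combination_iff {i j k : Fin 3} (h : Distinct i j k) {r s u v : Plane} {e : ℝ}
    (he : e * e = 1) (rj : hex j r = -e) (rk : hex k r = 0) (sj : hex j s = 0)
    (sk : hex k s = -e) :
    (∃ a b : ℝ, 0 < a ∧ 0 < b ∧ v = u + a • r + b • s) ↔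
      0 < e * (hex j u - hex j v) ∧ 0 < e * (hex k u - hex k v) := by
  constructor
  · rintro ⟨a, b, ha, hb, rfl⟩
    simp only [hex_add, hex_smul, rj, rk, sj, sk]
    constructor <;> ring_nf <;> simp_all [sq]
  · rintro ⟨a, b⟩
    -- Up to the factor -e, `r` and `s` are dual to `hex j` and `hex k`, so the coefficients are the
    -- signed coordinate differences.
    refine ⟨_, _, a, b, ?_⟩
    have key : ∀ l, l = j ∨ l = k → hex l v =
        hex l (u + (e * (hex j u - hex j v)) • r + (e * (hex k u - hex k v)) • s) := by
      rintro l (rfl | rfl)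
      · simp only [hex_add, hex_smul, rj, sj]
        linear_combination (hex l u - hex l v) * he
      · simp only [hex_add, hex_smul, rk, sk]
        linear_combination (hex l u - hex l v) * he
    have hj := key j (.inl rfl)
    have hk := key k (.inr rfl)
    have hi : hex i v =
        hex i (u + (e * (hex j u - hex j v)) • r + (e * (hex k u - hex k v)) • s) := by
      have h1 := h.hex_sum v
      have h2 := h.hex_sum (u + (e * (hex j u - hex j v)) • r + (e * (hex k u - hex k v)) • s)
      linarith
    have all : ∀ l, hex l v =
        hex l (u + (e * (hex j u - hex j v)) • r + (e * (hex k u - hex k v)) • s) := by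
      intro l
      rcases h.eq_or l with rfl | rfl | rfl <;> assumption
    exact plane_ext (all 0) (all 1)

lemma mem_posCone_iff (i : Fin 3) (u v : Plane) : v ∈ posCone i u ↔ Cone i u v := by
  obtain ⟨a0, a1, a2⟩ := hex_ray_zero
  obtain ⟨b0, b1, b2⟩ := hex_ray_one
  obtain ⟨c0, c1, c2⟩ := hex_ray_two
  have r3 : ray 3 = -ray 0 := ray_add_three 0
  have r4 : ray 4 = -ray 1 := ray_add_three 1
  have r5 : ray 5 = -ray 2 := ray_add_three 2
  have r6 : ray 6 = ray 0 := by rw [ray_add_three 3, r3, neg_neg]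
  fin_cases i
  · have h : Distinct 0 1 2 := by simp [Distinct]
    rw [show (⟨0, by norm_num⟩ : Fin 3) = 0 from rfl, h.cone_iff]
    refine (exists_combination_iff h (e := 1) (r := ray 1) (s := ray 2)
      (by norm_num) (by simp [b1]) b2 c1 (by simp [c2])).trans ?_
    simp
  · have h : Distinct 1 2 0 := by simp [Distinct]
    rw [show (⟨1, by norm_num⟩ : Fin 3) = 1 from rfl, h.cone_iff]
    refine (exists_combination_iff h (e := 1) (r := ray 3) (s := ray 4)
      (by norm_num) ?_ ?_ ?_ ?_).trans ?_ <;> simp [hex_neg, *]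
  · have h : Distinct 2 0 1 := by simp [Distinct]
    rw [show (⟨2, by norm_num⟩ : Fin 3) = 2 from rfl, h.cone_iff]
    refine (exists_combination_iff h (e := 1) (r := ray 5) (s := ray 6)
      (by norm_num) ?_ ?_ ?_ ?_).trans ?_ <;> simp [hex_neg, *]

lemma sector_add_three (k : ℕ) (u v : Plane) : v ∈ sector (k + 3) u ↔ u ∈ sector k v := by
  simp only [sector, Set.mem_ofPred_eq, ray_add_three]
  constructor <;> rintro ⟨a, b, ha, hb, h⟩ <;> exact ⟨a, b, ha, hb, by rw [h]; module⟩

lemma mem_negCone_iff (i : Fin 3) (u v : Plane) : v ∈ negCone i u ↔ Cone i v u := by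
  rw [← mem_posCone_iff, posCone, ← sector_add_three]; rfl

lemma GeneralPosition.hex_ne {P : Finset Plane} (hP : GeneralPosition P) (i : Fin 3) {u v : P}
    (h : u ≠ v) : hex i u ≠ hex i v := by
  intro e
  obtain ⟨a0, a1, a2⟩ := hex_ray_zero
  obtain ⟨b0, b1, b2⟩ := hex_ray_one
  obtain ⟨c0, c1, c2⟩ := hex_ray_two
  have hne : (u : Plane) ≠ v := fun h' => h (Subtype.ext h')
  have su := hex_sum u
  have sv := hex_sum v
  fin_cases i
  · refine hP u u.2 v v.2 hne 0 (hex 2 v - hex 2 u) (plane_ext ?_ ?_) <;>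
      simp only [hex_sub, hex_smul, a0, a1] <;> simp at e <;> linarith
  · refine hP u u.2 v v.2 hne 2 (hex 0 v - hex 0 u) (plane_ext ?_ ?_) <;>
      simp only [hex_sub, hex_smul, c0, c1] <;> simp at e <;> linarith
  · refine hP u u.2 v v.2 hne 1 (hex 0 v - hex 0 u) (plane_ext ?_ ?_) <;>
      simp only [hex_sub, hex_smul, b0, b1] <;> simp at e <;> linarith

/-- Law of cosines for oblique coordinates on two axes at angle π/3. -/
lemma Distinct.dist_sq {i j k : Fin 3} (h : Distinct i j k) (u v : Plane) :
    dist u v ^ 2 = (hex j u - hex j v) ^ 2 + (hex j u - hex j v) * (hex k u - hex k v) +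
      (hex k u - hex k v) ^ 2 := by
  have base : dist u v ^ 2 = ((hex 0 u - hex 0 v) ^ 2 + (hex 1 u - hex 1 v) ^ 2 +
      (hex 2 u - hex 2 v) ^ 2) / 2 := by
    rw [EuclideanSpace.dist_eq, Real.sq_sqrt (by positivity)]
    simp only [Fin.sum_univ_two, hex_zero, hex_one, hex_two, Real.dist_eq, sq_abs]
    linear_combination (-(u 1 - v 1) ^ 2 / 3) * sqrt_three_sq
  have e : (hex 0 u - hex 0 v) ^ 2 + (hex 1 u - hex 1 v) ^ 2 + (hex 2 u - hex 2 v) ^ 2 =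
      (hex i u - hex i v) ^ 2 + (hex j u - hex j v) ^ 2 + (hex k u - hex k v) ^ 2 := by
    obtain ⟨h1, h2, h3⟩ := h
    fin_cases i <;> fin_cases j <;> fin_cases k <;> simp_all <;> ring
  have hi : hex i u - hex i v = -(hex j u - hex j v) - (hex k u - hex k v) := by
    linarith [h.hex_sum u, h.hex_sum v]
  rw [base, e, hi]; ring

/-- All travelled lengths are estimated by this bound, which is additive along monotone paths. -/
lemma Distinct.dist_le {i j k : Fin 3} (h : Distinct i j k) (u v : Plane) :
    dist u v ≤ |hex j u - hex j v| + |hex k u - hex k v| := by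
  refine abs_le_of_sq_le_sq' ?_ (by positivity) |>.2
  rw [h.dist_sq]
  have := abs_mul_abs_self (hex j u - hex j v)
  have := abs_mul_abs_self (hex k u - hex k v)
  have := abs_mul (hex j u - hex j v) (hex k u - hex k v)
  have := le_abs_self ((hex j u - hex j v) * (hex k u - hex k v))
  have : 0 ≤ |hex j u - hex j v| * |hex k u - hex k v| := by positivity
  nlinarith

lemma clockwiseLT_iff (i : Fin 3) (u v w : Plane) :
    ClockwiseLT u v w ↔ (hex (i + 1) v - hex (i + 1) u) * (hex (i + 2) w - hex (i + 2) u) <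
      (hex (i + 2) v - hex (i + 2) u) * (hex (i + 1) w - hex (i + 1) u) := by
  have h3 := sqrt_three_pos
  have c : ∀ i : Fin 3, √3 / 2 * ((hex (i + 1) v - hex (i + 1) u) * (hex (i + 2) w - hex (i + 2) u) -
      (hex (i + 2) v - hex (i + 2) u) * (hex (i + 1) w - hex (i + 1) u)) =
      (v - u) 0 * (w - u) 1 - (v - u) 1 * (w - u) 0 := by
    intro i
    fin_cases i <;> simp [hex_zero, hex_one, hex_two]
    all_goals
      linear_combination (1 / 3) * ((v 0 - u 0) * (w 1 - u 1) - (v 1 - u 1) * (w 0 - u 0)) *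
        sqrt_three_sq
  rw [ClockwiseLT, ← c i, ← sub_neg (a := (hex (i + 1) v - hex (i + 1) u) * _)]
  constructor
  · intro H
    by_contra H'
    push Not at H'
    have : 0 ≤ √3 / 2 := by positivity
    nlinarith [mul_nonneg this H']
  · intro H
    exact mul_neg_of_pos_of_neg (by positivity) H

/-! ### Parents, children and siblings -/

variable {P : Finset Plane}

/-- `u` is the parent of `v` in the direction `i`: the closest vertex in the cone `C i` of `v`. -/
def IsParent (i : Fin 3) (v u : P) : Prop :=
  Cone i v u ∧ ∀ w : P, Cone i v w → hex i u ≤ hex i w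

/-- `w` is the next child after `v` of a common parent, in the direction of increasing `hex k`. -/
def IsSibling (i k : Fin 3) (v w : P) : Prop :=
  ∃ u : P, IsParent i v u ∧ IsParent i w u ∧ hex k v < hex k w ∧
    ∀ x : P, IsParent i x u → hex k v < hex k x → hex k w ≤ hex k x

/-- `c` is the closest child of `u`. -/
def IsClosestChild (i : Fin 3) (u c : P) : Prop :=
  IsParent i c u ∧ ∀ x : P, IsParent i x u → hex i x ≤ hex i c

/-- `c` is the child of `u` with the largest coordinate `hex k`. -/
def IsExtremeChild (i k : Fin 3) (u c : P) : Prop :=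
  IsParent i c u ∧ ∀ x : P, IsParent i x u → hex k x ≤ hex k c

lemma induction_on_value (f : P → ℝ) {C : P → Prop}
    (h : ∀ x, (∀ y, f y < f x → C y) → C x) (x : P) : C x := by
  let r : P → P → Prop := fun a b => f a < f b
  have : IsTrans P r := ⟨fun _ _ _ => lt_trans⟩
  have : Std.Irrefl r := ⟨fun _ => lt_irrefl _⟩
  exact (Finite.wellFounded_of_trans_of_irrefl r).induction x h

lemma exists_max_value (f : P → ℝ) {p : P → Prop} (h : ∃ x, p x) :
    ∃ x, p x ∧ ∀ y, p y → f y ≤ f x := by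
  obtain ⟨x, hx, hm⟩ := Set.exists_max_image {x | p x} f (Set.toFinite _) h
  exact ⟨x, hx, hm⟩

lemma IsParent.exists {i : Fin 3} {v w : P} (h : Cone i v w) : ∃ u : P, IsParent i v u := by
  obtain ⟨u, hu, hm⟩ := exists_max_value (fun u => -hex i u) (p := fun u : P => Cone i v u) ⟨w, h⟩
  exact ⟨u, hu, fun w hw => neg_le_neg_iff.1 (hm w hw)⟩

lemma GeneralPosition.parent_unique (hP : GeneralPosition P) {i : Fin 3} {v u u' : P}
    (h : IsParent i v u) (h' : IsParent i v u') : u = u' := by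
  by_contra hne
  exact hP.hex_ne i hne (le_antisymm (h.2 _ h'.1) (h'.2 _ h.1))

/-! ### Order and existence of children -/

variable {i j k : Fin 3}

namespace Distinct

lemma not_parent_of (h : Distinct i j k) {v u w : P} (hv : IsParent i v u)
    (h1 : hex j w < hex j v) (h2 : hex k w < hex k v) : hex i u ≤ hex i w :=
  hv.2 w (h.cone_iff.2 ⟨h1, h2⟩)

/-- Otherwise one sibling would lie in the cone C i of the other, closer than the common parent. So
the children form a staircase: the orders by `hex k`, by decreasing `hex j` and by angle agree. -/
lemma sibling_anti (h : Distinct i j k) (hP : GeneralPosition P) {u v w : P}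
    (hv : IsParent i v u) (hw : IsParent i w u) (hlt : hex k v < hex k w) :
    hex j w < hex j v := by
  by_contra hcon
  have hne : v ≠ w := by rintro rfl; exact lt_irrefl _ hlt
  have hj := lt_of_le_of_ne (not_lt.1 hcon) (hP.hex_ne j hne)
  have h1 := h.not_parent_of hw hj hlt
  have h2 := h.cone_iff.1 hv.1
  linarith [h.hex_sum u, h.hex_sum v]

/-- If no vertex of `C j` or `C k` of `s` interferes, a vertex in the negative cone `i` of `s`
yields a child of `s` in the parallelogram that they span. -/
lemma exists_child (h : Distinct i j k) (hP : GeneralPosition P) {s z₀ : P} (hz : Cone i z₀ s)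
    (hj : ∀ w : P, Cone j s w → ¬ hex j w < hex j z₀)
    (hk : ∀ w : P, Cone k s w → ¬ hex k w < hex k z₀) :
    ∃ z : P, IsParent i z s ∧ hex j z ≤ hex j z₀ ∧ hex k z ≤ hex k z₀ := by
  -- Take the vertex of the parallelogram nearest to `s`. A vertex closer than `s` in its cone C i
  -- would again lie in the parallelogram, or in C j or C k of `s`, where the hypotheses exclude it.
  obtain ⟨z, ⟨hz1, hz2, hz3⟩, hm⟩ := exists_max_value (fun z : P => hex i z)
    (p := fun z => Cone i z s ∧ hex j z ≤ hex j z₀ ∧ hex k z ≤ hex k z₀) ⟨z₀, hz, le_rfl, le_rfl⟩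
  refine ⟨z, ⟨hz1, fun w hw => ?_⟩, hz2, hz3⟩
  by_contra hlt
  have hwi := not_le.1 hlt
  have hws : w ≠ s := by rintro rfl; exact lt_irrefl _ hwi
  rw [h.cone_iff] at hw
  rcases lt_or_gt_of_ne (hP.hex_ne j hws) with hwj | hwj
  · refine hk w (h.rotate.rotate.cone_iff.2 ⟨hwi, hwj⟩) ?_
    linarith
  rcases lt_or_gt_of_ne (hP.hex_ne k hws) with hwk | hwk
  · refine hj w (h.rotate.cone_iff.2 ⟨hwk, hwi⟩) ?_
    linarith
  have := hm w ⟨h.cone_iff.2 ⟨hwj, hwk⟩, by linarith, by linarith⟩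
  linarith [h.hex_sum z, h.hex_sum w]

/-- The triangle spanned by a vertex and two consecutive children is empty. -/
lemma triangle_empty (h : Distinct i j k) (hP : GeneralPosition P) {s x y z : P}
    (hx : IsParent i x s) (hy : IsParent i y s)
    (hc : ∀ w : P, IsParent i w s → hex k x < hex k w → hex k y ≤ hex k w)
    (hj : hex j z < hex j x) (hk : hex k z < hex k y) : hex i s ≤ hex i z := by
  by_contra hlt
  have hzi := not_le.1 hlt
  have hzs : z ≠ s := by rintro rfl; exact lt_irrefl _ hzi
  have hxs := h.cone_iff.1 hx.1
  have hys := h.cone_iff.1 hy.1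
  have hzj : hex j s < hex j z := by
    refine lt_of_le_of_ne (not_lt.1 fun hlt' => ?_) (hP.hex_ne j hzs.symm)
    exact hlt (h.not_parent_of hy (by linarith) hk)
  have hzk : hex k s < hex k z := by
    refine lt_of_le_of_ne (not_lt.1 fun hlt' => ?_) (hP.hex_ne k hzs.symm)
    exact hlt (h.not_parent_of hx hj (by linarith))
  -- A vertex `z` in the triangle would produce a child strictly between `x` and `y`.
  obtain ⟨w, hw, hwj, hwk⟩ := h.exists_child hP (z₀ := z) (h.cone_iff.2 ⟨hzj, hzk⟩)
    (fun w hw hlt' => by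
      have hw := h.rotate.cone_iff.1 hw
      have := h.not_parent_of hx (w := w) (by linarith) (by linarith)
      linarith)
    (fun w hw hlt' => by
      have hw := h.rotate.rotate.cone_iff.1 hw
      have := h.not_parent_of hy (w := w) (by linarith) (by linarith)
      linarith)
  have := h.swap.sibling_anti hP hw hx (by linarith)
  have := hc w hw this
  linarith

/-- There is a child of `s` in the parallelogram spanned by `s` and `t` if the extreme children
of `s` do not rule it out. -/
lemma exists_child_of_extreme (h : Distinct i j k) (hP : GeneralPosition P) {s t a b : P}
    (ht : Cone i t s) (ha : IsParent i a s) (hb : IsParent i b s) (haj : hex j a ≤ hex j t)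
    (hbk : hex k b ≤ hex k t) :
    ∃ z : P, IsParent i z s ∧ hex j z ≤ hex j t ∧ hex k z ≤ hex k t := by
  by_cases h1 : hex k a ≤ hex k t
  · exact ⟨a, ha, haj, h1⟩
  by_cases h2 : hex j b ≤ hex j t
  · exact ⟨b, hb, h2, hbk⟩
  have hs := h.cone_iff.1 ht
  -- A vertex of C j of `s` below the level of `t` would lie in C i of `b`, closer than `s`;
  -- likewise for C k and `a`.
  refine h.exists_child hP ht (fun w hw hlt => ?_) (fun w hw hlt => ?_)
  · have hw := h.rotate.cone_iff.1 hw
    have := h.not_parent_of hb (w := w) (by linarith) (by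
      have := h.cone_iff.1 hb.1
      linarith)
    linarith
  · have hw := h.rotate.rotate.cone_iff.1 hw
    have := h.not_parent_of ha (w := w) (by
      have := h.cone_iff.1 ha.1
      linarith) (by linarith)
    linarith

end Distinct

/-- The part of the cone `C k` of `s` that lies in the triangle of `t` and `s` has a vertex. -/
def SideOccupied (k : Fin 3) (s t : P) : Prop := ∃ z : P, Cone k s z ∧ hex k z < hex k t

/-! ### Sides that stay free along the route -/

namespace Distinct

lemma exists_child_of_sides_free (h : Distinct i j k) (hP : GeneralPosition P) {s t : P}
    (ht : Cone i t s) (hj : ¬ SideOccupied j s t) (hk : ¬ SideOccupied k s t) :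
    ∃ z : P, IsParent i z s ∧ hex j z ≤ hex j t ∧ hex k z ≤ hex k t :=
  h.exists_child hP ht (fun w hw hlt => hj ⟨w, hw, hlt⟩) (fun w hw hlt => hk ⟨w, hw, hlt⟩)

/-- A vertex in the side of `v` lies either in the side of `s` or in the negative cone of `s`. In
the latter case it produces a child beyond `v` but not beyond `t`, against the maximality of `v`. -/
lemma side_free_child (h : Distinct i j k) (hP : GeneralPosition P) {s t v : P}
    (hk : ¬ SideOccupied k s t) (hv : IsParent i v s)
    (hm : ∀ x : P, IsParent i x s → hex k x ≤ hex k t → hex k x ≤ hex k v) :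
    ¬ SideOccupied k v t := by
  rintro ⟨z, hz, hzt⟩
  have hz := h.rotate.rotate.cone_iff.1 hz
  have hvs := h.cone_iff.1 hv.1
  have sz := h.hex_sum z
  have sv := h.hex_sum v
  have ss := h.hex_sum s
  have hzs : z ≠ s := by rintro rfl; linarith
  have hzj : hex j s < hex j z := by
    refine lt_of_le_of_ne (not_lt.1 fun hlt' => ?_) (hP.hex_ne j hzs.symm)
    exact hk ⟨z, h.rotate.rotate.cone_iff.2 ⟨by linarith, hlt'⟩, hzt⟩
  obtain ⟨w, hw, hwj, hwk⟩ := h.exists_child hP (z₀ := z) (h.cone_iff.2 ⟨hzj, by linarith⟩)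
    (fun w hw hlt' => by
      have hw := h.rotate.cone_iff.1 hw
      have := h.not_parent_of hv (w := w) (by linarith) (by linarith)
      linarith)
    (fun w hw hlt' => hk ⟨w, hw, hlt'.trans hzt⟩)
  have := h.swap.sibling_anti hP hw hv (by linarith)
  have := hm w hw (by linarith)
  linarith

/-- A vertex in the side of `v` would occupy the side of `s`, or be closer to `s` than `v` in C j,
or produce a child in the parallelogram. -/
lemma side_free_parent (h : Distinct i j k) (hP : GeneralPosition P) {s t v : P}
    (hk : ¬ SideOccupied k s t) (hv : IsParent j s v) (hvt : hex j v < hex j t)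
    (hn : ¬ ∃ z : P, IsParent i z s ∧ hex j z ≤ hex j t ∧ hex k z ≤ hex k t) :
    ¬ SideOccupied k v t := by
  rintro ⟨z, hz, hzt⟩
  have hz := h.rotate.rotate.cone_iff.1 hz
  have hvs := h.rotate.cone_iff.1 hv.1
  have hzs : z ≠ s := by rintro rfl; linarith
  have hzj : hex j s < hex j z := by
    refine lt_of_le_of_ne (not_lt.1 fun hlt' => ?_) (hP.hex_ne j hzs.symm)
    exact hk ⟨z, h.rotate.rotate.cone_iff.2 ⟨by linarith, hlt'⟩, hzt⟩
  have hzk : hex k s < hex k z := by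
    refine lt_of_le_of_ne (not_lt.1 fun hlt' => ?_) (hP.hex_ne k hzs.symm)
    have := h.rotate.not_parent_of hv hlt' (by linarith)
    linarith
  obtain ⟨w, hw, hwj, hwk⟩ := h.exists_child hP (z₀ := z) (h.cone_iff.2 ⟨hzj, hzk⟩)
    (fun w hw hlt' => by
      have := hv.2 w hw
      linarith)
    (fun w hw hlt' => hk ⟨w, hw, hlt'.trans hzt⟩)
  exact hn ⟨w, hw, by linarith, by linarith⟩

/-- A vertex in this side of `v` would be closer to `s` than its parent `v`. -/
lemma side_free_positive (h : Distinct i j k) {s t v : P} (ht : Cone i s t)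
    (hv : IsParent i s v) : ¬ SideOccupied k v t := by
  rintro ⟨z, hz, hzt⟩
  have hz := h.rotate.rotate.cone_iff.1 hz
  have hvs := h.cone_iff.1 hv.1
  have ht := h.cone_iff.1 ht
  have := h.not_parent_of hv (w := z) (by linarith) (by linarith)
  linarith

end Distinct

/-! ### The edges of the graphs -/

lemma distinct_add (i : Fin 3) : Distinct i (i + 1) (i + 2) := by
  revert i
  unfold Distinct
  decide

lemma isClosestPos_iff {u v : P} : IsClosestPos P i u v ↔ IsParent i u v := by
  have h3 : 0 < √3 / 2 := by have := sqrt_three_pos; positivity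
  simp only [IsClosestPos, IsParent, mem_posCone_iff, bisectorProj_pos, mul_le_mul_iff_right₀ h3,
    sub_le_sub_iff_right]

lemma cone_unique {i' : Fin 3} {u v : Plane} (h : Cone i u v) (h' : Cone i' u v) : i = i' := by
  by_contra hne
  have d := distinct_add i
  have h1 := d.cone_iff.1 h
  have h2 := h' i hne
  linarith [d.hex_sum u, d.hex_sum v]

lemma Cone.not_symm {i' : Fin 3} {u v : Plane} (h : Cone i u v) : ¬ Cone i' v u := by
  intro h'
  have d := distinct_add i
  have h1 := d.cone_iff.1 h
  rcases d.eq_or i' with rfl | rfl | rfl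
  · linarith [d.cone_iff.1 h']
  · linarith [h' (i + 2) d.2.2.symm]
  · linarith [h' (i + 1) d.2.2]

lemma Cone.ne {u v : P} (h : Cone i u v) : u ≠ v := by
  rintro rfl
  exact h.not_symm h

lemma halfTheta6_adj_iff {u v : P} :
    (halfTheta6 P).Adj u v ↔ (∃ i, IsParent i u v) ∨ ∃ i, IsParent i v u := by
  simp only [halfTheta6, SimpleGraph.fromRel_adj, isClosestPos_iff, and_iff_right_iff_imp]
  rintro (⟨i, h⟩ | ⟨i, h⟩)
  · exact h.1.ne
  · exact h.1.ne.symm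

lemma mem_negNbrs_iff {u v : P} : v ∈ negNbrs P i u ↔ IsParent i v u := by
  simp only [negNbrs, Set.mem_ofPred_eq, halfTheta6_adj_iff, mem_negCone_iff]
  constructor
  · rintro ⟨⟨i', h⟩ | ⟨i', h⟩, hc⟩
    · exact absurd h.1 hc.not_symm
    · rwa [cone_unique hc h.1]
  · exact fun h => ⟨.inr ⟨i, h⟩, h.1⟩

lemma isClosestNeg_iff {u v : P} : IsClosestNeg P i u v ↔ IsClosestChild i u v := by
  have h3 : 0 < √3 / 2 := by have := sqrt_three_pos; positivity
  simp only [IsClosestNeg, IsClosestChild, mem_negNbrs_iff, bisectorProj_neg,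
    mul_le_mul_iff_right₀ h3, sub_le_sub_iff_left]

lemma GeneralPosition.clockwiseLT_iff_of_children (hP : GeneralPosition P) {u v w : P}
    (hv : IsParent i v u) (hw : IsParent i w u) :
    ClockwiseLT u v w ↔ hex (i + 1) v < hex (i + 1) w := by
  have d := distinct_add i
  have hv' := d.cone_iff.1 hv.1
  have hw' := d.cone_iff.1 hw.1
  rw [clockwiseLT_iff i]
  constructor
  · intro H
    by_contra hcon
    have h2 : hex (i + 2) v ≤ hex (i + 2) w := by
      rcases eq_or_ne v w with rfl | hne
      · exact le_rfl
      · exact (d.swap.sibling_anti hP hw hv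
          (lt_of_le_of_ne (not_lt.1 hcon) (hP.hex_ne _ hne.symm))).le
    nlinarith
  · intro H
    have := d.swap.sibling_anti hP hv hw H
    nlinarith

lemma IsClosestChild.adj_G9 {u c : P} (h : IsClosestChild i u c) : (G9 P).Adj u c := by
  refine (SimpleGraph.fromRel_adj _ _ _).2 ⟨h.1.1.ne.symm, .inl ⟨?_, .inl ⟨i, ?_⟩⟩⟩
  · exact halfTheta6_adj_iff.2 (.inr ⟨i, h.1⟩)
  · exact isClosestNeg_iff.2 h

lemma IsClosestChild.adj_G12 {u c : P} (h : IsClosestChild i u c) : (G12 P).Adj u c :=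
  (SimpleGraph.fromRel_adj _ _ _).2
    ⟨h.1.1.ne.symm, .inl ⟨i, .inr (.inr (isClosestNeg_iff.2 h))⟩⟩

lemma Distinct.adj_G12_of_extreme (h : Distinct i j k) (hP : GeneralPosition P) {u v : P}
    (hv : IsParent i v u) (hm : ∀ w : P, IsParent i w u → hex j v ≤ hex j w) :
    (G12 P).Adj u v := by
  refine (SimpleGraph.fromRel_adj _ _ _).2 ⟨hv.1.ne.symm, .inl ⟨i, ?_⟩⟩
  have d := distinct_add i
  rcases (d.eq_or j).resolve_left h.1.symm with rfl | rfl
  · refine .inl ⟨mem_negNbrs_iff.2 hv, fun w hw hne => ?_⟩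
    rw [mem_negNbrs_iff] at hw
    rw [hP.clockwiseLT_iff_of_children hv hw]
    exact lt_of_le_of_ne (hm w hw) (hP.hex_ne _ hne.symm)
  · refine .inr (.inl ⟨mem_negNbrs_iff.2 hv, fun w hw hne => ?_⟩)
    rw [mem_negNbrs_iff] at hw
    rw [hP.clockwiseLT_iff_of_children hw hv]
    exact d.sibling_anti hP hv hw (lt_of_le_of_ne (hm w hw) (hP.hex_ne _ hne.symm))

lemma Distinct.sibling_symm (h : Distinct i j k) (hP : GeneralPosition P) {v w : P}
    (hs : IsSibling i k v w) : IsSibling i j w v := by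
  obtain ⟨u, hv, hw, hlt, hm⟩ := hs
  refine ⟨u, hw, hv, h.sibling_anti hP hv hw hlt, fun x hx hxj => ?_⟩
  by_contra hcon
  have := h.swap.sibling_anti hP hw hx hxj
  have := hm x hx (h.swap.sibling_anti hP hx hv (not_le.1 hcon))
  linarith

/-- A closer candidate for the parent of `x` would lie in the empty triangle of `x`, `y` and their
common parent `s`. A child of `y` beyond `x` would lie in that triangle or have `s` as a closer
vertex in its cone C k. So `x` is an extreme child of `y`, and G₁₂ keeps the edge. -/
lemma Distinct.sibling_adj_of_lt (h : Distinct i j k) (hP : GeneralPosition P) {x y : P}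
    (hs : IsSibling i k x y) (hlt : hex i y < hex i x) :
    IsParent k x y ∧ (G12 P).Adj y x := by
  obtain ⟨s, hx, hy, hxy, hm⟩ := hs
  have hxs := h.cone_iff.1 hx.1
  have hys := h.cone_iff.1 hy.1
  have hyx := h.sibling_anti hP hx hy hxy
  have hpar : IsParent k x y := by
    refine ⟨h.rotate.rotate.cone_iff.2 ⟨hlt, hyx⟩, fun w hw => ?_⟩
    by_contra hcon
    have hw := h.rotate.rotate.cone_iff.1 hw
    have := h.triangle_empty hP hx hy hm hw.2 (not_le.1 hcon)
    linarith [h.hex_sum x, h.hex_sum s]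
  refine ⟨hpar, h.rotate.rotate.swap.adj_G12_of_extreme hP hpar fun w hw => ?_⟩
  by_contra hcon
  have hwy := h.rotate.rotate.cone_iff.1 hw.1
  have h1 := h.triangle_empty hP hx hy hm (z := w) (not_le.1 hcon)
    (by linarith [h.hex_sum y, h.hex_sum w])
  have hws : s ≠ w := by rintro rfl; linarith
  have := h.rotate.rotate.not_parent_of hw (w := s) (lt_of_le_of_ne h1 (hP.hex_ne i hws))
    (by linarith)
  linarith

lemma Distinct.sibling_adj (h : Distinct i j k) (hP : GeneralPosition P) {x y : P}
    (hs : IsSibling i k x y) : (halfTheta6 P).Adj x y ∧ (G12 P).Adj x y := by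
  have hne : x ≠ y := by
    rintro rfl
    obtain ⟨s, hx, hy, hxy, hm⟩ := hs
    exact lt_irrefl _ hxy
  rcases lt_or_gt_of_ne (hP.hex_ne i hne) with hlt | hlt
  · have := h.swap.sibling_adj_of_lt hP (h.sibling_symm hP hs) hlt
    exact ⟨halfTheta6_adj_iff.2 (.inr ⟨_, this.1⟩), this.2⟩
  · have := h.sibling_adj_of_lt hP hs hlt
    exact ⟨halfTheta6_adj_iff.2 (.inl ⟨_, this.1⟩), this.2.symm⟩

lemma IsSibling.adj_G9_of_add_one (hP : GeneralPosition P) {x y : P}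
    (hs : IsSibling i (i + 1) x y) : (G9 P).Adj x y := by
  have hadj := ((distinct_add i).swap.sibling_adj hP hs).1
  refine (SimpleGraph.fromRel_adj _ _ _).2 ⟨hadj.ne, .inl ⟨hadj, .inr ?_⟩⟩
  obtain ⟨s, hx, hy, hxy, hm⟩ := hs
  refine ⟨i, s, mem_negNbrs_iff.2 hx, mem_negNbrs_iff.2 hy,
    (hP.clockwiseLT_iff_of_children hx hy).2 hxy, fun z hz => ?_⟩
  rw [mem_negNbrs_iff] at hz
  rw [hP.clockwiseLT_iff_of_children hx hz, hP.clockwiseLT_iff_of_children hz hy]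
  rintro ⟨h1, h2⟩
  exact absurd (hm z hz h1) (not_le.2 h2)

lemma Distinct.sibling_adj_G9 (h : Distinct i j k) (hP : GeneralPosition P) {x y : P}
    (hs : IsSibling i k x y) : (G9 P).Adj x y := by
  have d := distinct_add i
  rcases (d.eq_or k).resolve_left h.2.1.symm with rfl | rfl
  · exact hs.adj_G9_of_add_one hP
  · exact ((d.sibling_symm hP hs).adj_G9_of_add_one hP).symm

/-! ### The information stored at the vertices -/

/-- The names of the points stored at a vertex. -/
abbrev Slot : Type := Fin 5 × Fin 3 × Fin 3

/-- The relation of a vertex to the vertex that it stores under a given name: its parents, its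
siblings, its closest children, its extreme children and its siblings that are closest to the
common parent. -/
def slotRel (x : Slot) : P → P → Prop :=
  (![fun i _ => IsParent i, IsSibling, fun i _ => IsClosestChild i, IsExtremeChild,
    fun i _ v w => ∃ u, IsParent i v u ∧ IsClosestChild i u w] :
      Fin 5 → Fin 3 → Fin 3 → P → P → Prop) x.1 x.2.1 x.2.2

open Classical in
/-- The vertex stored at `v` under the name `x`; it is `v` itself if there is none to store. -/
def storedVertex (v : P) (x : Slot) : P := if h : ∃ w, slotRel x v w then h.choose else v

/-- The points stored at `v`. -/
def storedPoint (v : P) (x : Slot) : Plane := storedVertex v x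

lemma storedVertex_spec {v : P} {x : Slot} (h : ∃ w, slotRel x v w) :
    slotRel x v (storedVertex v x) := by
  rw [storedVertex, dif_pos h]
  exact h.choose_spec

/-- With this default, a strict comparison of coordinates with the stored point fails exactly as it
should when nothing is stored. -/
lemma storedVertex_eq {v : P} {x : Slot} (h : ¬ ∃ w, slotRel x v w) : storedVertex v x = v :=
  dif_neg h

lemma IsExtremeChild.exists {u v : P} (k : Fin 3) (h : IsParent i v u) :
    ∃ c, IsExtremeChild i k u c :=
  exists_max_value (fun c : P => hex k c) ⟨v, h⟩

lemma IsSibling.exists {u v w : P} (hv : IsParent i v u) (hw : IsParent i w u)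
    (hlt : hex k v < hex k w) : ∃ x, IsSibling i k v x := by
  obtain ⟨x, ⟨hx, hvx⟩, hm⟩ := exists_max_value (fun x : P => -hex k x)
    (p := fun x => IsParent i x u ∧ hex k v < hex k x) ⟨w, hw, hlt⟩
  exact ⟨x, u, hv, hx, hvx, fun z hz hlt => neg_le_neg_iff.1 (hm z ⟨hz, hlt⟩)⟩

namespace GeneralPosition

lemma stored_parent (hP : GeneralPosition P) {v u : P} (h : IsParent i v u) (l : Fin 3) :
    storedVertex v (0, i, l) = u :=
  hP.parent_unique (i := i) (storedVertex_spec (x := (0, i, l)) ⟨u, h⟩) h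

lemma sibling_of_parent (hP : GeneralPosition P) {u v w : P} (hv : IsParent i v u)
    (hw : IsSibling i k v w) : IsParent i w u ∧ hex k v < hex k w ∧
      ∀ x : P, IsParent i x u → hex k v < hex k x → hex k w ≤ hex k x := by
  obtain ⟨u', hv', h⟩ := hw
  rwa [hP.parent_unique hv hv']

lemma closestChild_unique (hP : GeneralPosition P) {u c c' : P} (h : IsClosestChild i u c)
    (h' : IsClosestChild i u c') : c = c' := by
  by_contra hne
  exact hP.hex_ne i hne (le_antisymm (h'.2 _ h.1) (h.2 _ h'.1))

lemma stored_closestChild (hP : GeneralPosition P) {u c : P} (h : IsClosestChild i u c)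
    (l : Fin 3) : storedVertex u (2, i, l) = c :=
  hP.closestChild_unique (i := i) (storedVertex_spec (x := (2, i, l)) ⟨c, h⟩) h

lemma stored_closestSibling (hP : GeneralPosition P) {u v c : P} (hv : IsParent i v u)
    (h : IsClosestChild i u c) (l : Fin 3) : storedVertex v (4, i, l) = c := by
  obtain ⟨u', hu', hc⟩ := storedVertex_spec (x := (4, i, l)) ⟨c, u, hv, h⟩
  rw [hP.parent_unique hu' hv] at hc
  exact hP.closestChild_unique (i := i) hc h

end GeneralPosition

/-- The stored points as a list of memory contents. -/
def encodeInfo (I : Slot → Plane) : List MemCell :=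
  (Finset.univ : Finset Slot).toList.map fun x => MemCell.pt (I x)

lemma encodeInfo_injective : Function.Injective encodeInfo := by
  intro I J h
  funext x
  have := List.map_inj_left.1 h x (by simp)
  simpa using this

/-- The points that a list of memory contents stands for. -/
def decodeInfo : List MemCell → Slot → Plane := Function.invFun encodeInfo

lemma decodeInfo_encodeInfo (I : Slot → Plane) : decodeInfo (encodeInfo I) = I :=
  Function.leftInverse_invFun encodeInfo_injective I

/-- 45 = 5 · 3 · 3 is the number of slots. -/
lemma fitsMemory_encodeInfo (v : P) : FitsMemory P 45 (encodeInfo (storedPoint v)) := by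
  constructor
  · simp [encodeInfo]
  · intro c hc
    obtain ⟨x, -, rfl⟩ := List.mem_map.1 hc
    exact (storedVertex v x).2

/-! ### The algorithm -/

/-- What the message is doing: it is about to decide on an edge of the half-θ₆-graph, or it
follows the edge to the parent in the direction `i`, or it follows an edge to a child in the
negative cone `i`, the one with the largest coordinate `hex k` not beyond the destination. -/
inductive Mode : Type
  | decide
  | up (i : Fin 3)
  | down (i k : Fin 3)

/-- The number of a mode. -/
def Mode.code : Mode → ℕ
  | .decide => 0
  | .up i => i + 1
  | .down i k => 3 * i + k + 4

lemma Mode.code_injective : Function.Injective Mode.code := by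
  rintro (_ | a | ⟨a, b⟩) (_ | c | ⟨c, d⟩) h <;> simp only [Mode.code] at h
  all_goals first
    | rfl
    | omega
    | (congr 1 <;> apply Fin.ext <;> omega)

lemma Mode.code_le (m : Mode) : m.code ≤ 45 := by
  rcases m with _ | a | ⟨a, b⟩ <;> simp only [Mode.code] <;> omega

/-- A mode as memory contents. -/
def encodeMode (m : Mode) : List MemCell := List.replicate m.code (MemCell.int 0)

lemma encodeMode_injective : Function.Injective encodeMode := fun m m' h =>
  Mode.code_injective (by simpa [encodeMode] using congrArg List.length h)

instance : Nonempty Mode := ⟨.decide⟩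

/-- The mode that memory contents stand for. -/
def decodeMode : List MemCell → Mode := Function.invFun encodeMode

lemma decodeMode_encodeMode (m : Mode) : decodeMode (encodeMode m) = m :=
  Function.leftInverse_invFun encodeMode_injective m

/-- The code is unary because 0 is the only integer that is valid for every nonempty `P`. The mode
`decide` is the empty list, as at the start. -/
lemma fitsMemory_encodeMode (v : P) (m : Mode) : FitsMemory P 45 (encodeMode m) := by
  constructor
  · simpa [encodeMode] using m.code_le
  · intro c hc
    rw [List.eq_of_mem_replicate hc]
    exact Finset.card_pos.2 ⟨v, v.2⟩

/-- The part of the cone `C k` of `s` in the triangle of `t` and `s` is seen to have a vertex. -/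
def SeesOccupied (I : Slot → Plane) (s t : Plane) (k : Fin 3) : Prop :=
  hex k s < hex k (I (0, k, 0)) ∧ hex k (I (0, k, 0)) < hex k t

/-- The side `j` is preferred to the side `k`: it is the only occupied one, or the two sides are
both occupied or both free and `j` is the shorter one. -/
def Prefers (I : Slot → Plane) (s t : Plane) (j k : Fin 3) : Prop :=
  SeesOccupied I s t j ∧ ¬ SeesOccupied I s t k ∨
    (SeesOccupied I s t j ↔ SeesOccupied I s t k) ∧ hex j t - hex j s ≤ hex k t - hex k s

/-- There is seen to be a child of `s` in the parallelogram of `s` and `t`. -/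
def SeesChild (I : Slot → Plane) (s t : Plane) (i j k : Fin 3) : Prop :=
  (hex j s < hex j (I (3, i, k)) ∧ hex j (I (3, i, k)) ≤ hex j t) ∧
    (hex k s < hex k (I (3, i, j)) ∧ hex k (I (3, i, j)) ≤ hex k t)

open Classical in
/-- The step towards the parent in the direction `i`. -/
def upStep (I : Slot → Plane) (s : Plane) (i : Fin 3) : Plane × Mode :=
  if h : ∃ k, k ≠ i ∧ hex k s < hex k (I (4, i, 0)) then (I (1, i, h.choose), .up i)
  else (I (0, i, 0), .decide)

open Classical in
/-- The first step if `t` lies in the negative cone `i` of `s` and the side `j` is preferred. -/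
def negStep (I : Slot → Plane) (s t : Plane) (i j k : Fin 3) : Plane × Mode :=
  if SeesChild I s t i j k then (I (2, i, 0), .down i k) else upStep I s j

open Classical in
/-- The first step along a newly chosen edge. -/
def decideStep (I : Slot → Plane) (s t : Plane) : Plane × Mode :=
  if h : ∃ i, Cone i s t then upStep I s h.choose
  else if h : ∃ c : Fin 3 × Fin 3 × Fin 3, Distinct c.1 c.2.1 c.2.2 ∧ Cone c.1 t s ∧
      Prefers I s t c.2.1 c.2.2 then
    negStep I s t h.choose.1 h.choose.2.1 h.choose.2.2
  else (s, .decide)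

open Classical in
/-- The next step in each mode. -/
def step (I : Slot → Plane) (s t : Plane) : Mode → Plane × Mode
  | .decide => decideStep I s t
  | .up i => upStep I s i
  | .down i k =>
    if hex k t < hex k s then (I (1, i, -(i + k)), .down i k)
    else if hex k s < hex k (I (1, i, k)) ∧ hex k (I (1, i, k)) ≤ hex k t then
      (I (1, i, k), .down i k)
    else decideStep I s t

/-- The routing algorithm. -/
def router : RoutingAlgorithm where
  next s t _ info mem :=
    ((step (decodeInfo info) s t (decodeMode mem)).1,
      encodeMode (step (decodeInfo info) s t (decodeMode mem)).2)

/-! ### The choice of a new edge -/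

lemma decideStep_pos {I : Slot → Plane} {s t : Plane} (h : Cone i s t) :
    decideStep I s t = upStep I s i := by
  have h' : ∃ i, Cone i s t := ⟨i, h⟩
  rw [decideStep, dif_pos h', cone_unique h'.choose_spec h]

/-- In a tie either order of the sides may have been chosen; only its defining property is
available. -/
lemma Distinct.exists_decideStep_neg (h : Distinct i j k) {I : Slot → Plane} {s t : Plane}
    (ht : Cone i t s) : ∃ j k, Distinct i j k ∧ Prefers I s t j k ∧
      decideStep I s t = negStep I s t i j k := by
  have h' : ∃ c : Fin 3 × Fin 3 × Fin 3, Distinct c.1 c.2.1 c.2.2 ∧ Cone c.1 t s ∧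
      Prefers I s t c.2.1 c.2.2 := by
    by_cases hj : SeesOccupied I s t j <;> by_cases hk : SeesOccupied I s t k <;>
    rcases le_total (hex j t - hex j s) (hex k t - hex k s) with hle | hle
    all_goals first
      | exact ⟨(i, j, k), h, ht, .inl ⟨hj, hk⟩⟩
      | exact ⟨(i, k, j), h.swap, ht, .inl ⟨hk, hj⟩⟩
      | exact ⟨(i, j, k), h, ht, .inr ⟨by tauto, hle⟩⟩
      | exact ⟨(i, k, j), h.swap, ht, .inr ⟨by tauto, hle⟩⟩
  have hn : ¬ ∃ i, Cone i s t := fun ⟨_, hc⟩ => hc.not_symm ht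
  obtain ⟨h1, h2, h3⟩ := h'.choose_spec
  have e := cone_unique h2 ht
  refine ⟨h'.choose.2.1, h'.choose.2.2, by rwa [← e], h3, ?_⟩
  rw [decideStep, dif_neg hn, dif_pos h', e]

/-- In `G`, the router brings a message for `t` from `s` in mode `m` to `t` within the
distance `B`. -/
def Reaches (G : SimpleGraph P) (t s : P) (m : Mode) (B : ℝ) : Prop :=
  ∃ L ≤ B, router.Route G 1 45 (fun v => encodeInfo (storedPoint v)) t s (encodeMode m) L

lemma RoutingAlgorithm.Route.nonneg {A : RoutingAlgorithm} {G : SimpleGraph P} {n m : ℕ}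
    {info : P → List MemCell} {t s : P} {M : List MemCell} {L : ℝ}
    (h : A.Route G n m info t s M L) : 0 ≤ L := by
  induction h with
  | arrived => exact le_rfl
  | forward s v M M' L _ _ _ _ _ ih => positivity

namespace Reaches

variable {G : SimpleGraph P} {s t : P} {m : Mode} {B B' : ℝ}

lemma nonneg (h : Reaches G t s m B) : 0 ≤ B := by
  obtain ⟨L, hL, hr⟩ := h
  exact hr.nonneg.trans hL

lemma mono (h : Reaches G t s m B) (hB : B ≤ B') : Reaches G t s m B' := by
  obtain ⟨L, hL, hr⟩ := h
  exact ⟨L, hL.trans hB, hr⟩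

lemma refl (t : P) (m : Mode) (hB : 0 ≤ B) : Reaches G t t m B := ⟨0, hB, .arrived _⟩

lemma forward {v : P} {m' : Mode} (hv : Reaches G t v m' B) (hadj : G.Adj s v)
    (hs : step (storedPoint s) s t m = ((v : Plane), m')) (hB : dist (s : Plane) v + B ≤ B') :
    Reaches G t s m B' := by
  rcases eq_or_ne s t with rfl | hne
  · exact refl s m (by have := hv.nonneg; have : 0 ≤ dist (s : Plane) v := dist_nonneg; linarith)
  · obtain ⟨L, hL, hr⟩ := hv
    refine ⟨dist (s : Plane) v + L, by linarith, .forward s v _ _ L hne ?_ hadj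
      (fitsMemory_encodeMode v m') hr⟩
    simp only [router, decodeInfo_encodeInfo, decodeMode_encodeMode, hs]

/-- Changes mode without moving: a vertex where one mode ends takes the same step as in the next
mode. -/
lemma congr_mode {m' : Mode} (hv : Reaches G t s m B)
    (hs : step (storedPoint s) s t m' = step (storedPoint s) s t m) : Reaches G t s m' B := by
  obtain ⟨L, hL, hr⟩ := hv
  refine ⟨L, hL, ?_⟩
  cases hr with
  | arrived => exact .arrived _
  | forward _ v _ M' L hne hn hadj hf hr =>
    refine .forward s v _ M' L hne ?_ hadj hf hr
    rw [← hn]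
    simp only [router, decodeInfo_encodeInfo, decodeMode_encodeMode, hs]

end Reaches

/-- `G` contains the edges to the closest children and between consecutive siblings. -/
def HasRoutingEdges (G : SimpleGraph P) : Prop :=
  (∀ i (u c : P), IsClosestChild i u c → G.Adj u c) ∧
    ∀ i j k (v w : P), Distinct i j k → IsSibling i k v w → G.Adj v w

/-- The only place where the definitions of the two graphs enter the routing. -/
lemma GeneralPosition.hasRoutingEdges (hP : GeneralPosition P) {G : SimpleGraph P}
    (hG : G = G9 P ∨ G = G12 P) : HasRoutingEdges G := by
  rcases hG with rfl | rfl
  · exact ⟨fun _ _ _ h => h.adj_G9, fun _ _ _ _ _ h hs => h.sibling_adj_G9 hP hs⟩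
  · exact ⟨fun _ _ _ h => h.adj_G12, fun _ _ _ _ _ h hs => (h.sibling_adj hP hs).2⟩

/-! ### Correctness and competitiveness -/

variable {G : SimpleGraph P}

lemma storedPoint_eq {v w : P} {x : Slot} (h : storedVertex v x = w) : storedPoint v x = w := by
  rw [storedPoint, h]

/-- If the side has any vertex, the parent in the direction `k` is one. -/
lemma seesOccupied_iff {s t : P} :
    SeesOccupied (storedPoint s) s t k ↔ SideOccupied k s t := by
  constructor
  · rintro ⟨h1, h2⟩
    by_cases h : ∃ w, slotRel (0, k, 0) s w
    · exact ⟨_, (show IsParent k s _ from storedVertex_spec h).1, h2⟩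
    · rw [storedPoint, storedVertex_eq h] at h1
      exact absurd h1 (lt_irrefl _)
  · rintro ⟨z, hz, hzt⟩
    obtain ⟨u, hu⟩ := IsParent.exists hz
    have hs : IsParent k s (storedVertex s (0, k, 0)) :=
      storedVertex_spec (x := (0, k, 0)) ⟨u, hu⟩
    have d := distinct_add k
    have h1 := d.cone_iff.1 hs.1
    have h2 := hs.2 z hz
    refine ⟨?_, h2.trans_lt hzt⟩
    simp only [storedPoint]
    linarith [d.hex_sum s, d.hex_sum (storedVertex s (0, k, 0))]

/-! ### Local tests and the cost of replacing an edge -/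

namespace Distinct

/-- The child with the largest `hex k` has the smallest `hex j`, and vice versa, so the two extreme
children decide the question even if neither lies in the parallelogram. -/
lemma seesChild_iff (h : Distinct i j k) (hP : GeneralPosition P) {s t : P} (ht : Cone i t s) :
    SeesChild (storedPoint s) s t i j k ↔
      ∃ z : P, IsParent i z s ∧ hex j z ≤ hex j t ∧ hex k z ≤ hex k t := by
  constructor
  · rintro ⟨⟨h1, h2⟩, h3, h4⟩
    have hk : IsExtremeChild i k s (storedVertex s (3, i, k)) := by
      by_contra hn
      have : ¬ ∃ w, slotRel (3, i, k) s w := fun hw => hn (storedVertex_spec hw)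
      rw [storedPoint, storedVertex_eq this] at h1
      exact lt_irrefl _ h1
    have hj : IsExtremeChild i j s (storedVertex s (3, i, j)) := by
      by_contra hn
      have : ¬ ∃ w, slotRel (3, i, j) s w := fun hw => hn (storedVertex_spec hw)
      rw [storedPoint, storedVertex_eq this] at h3
      exact lt_irrefl _ h3
    exact h.exists_child_of_extreme hP ht hk.1 hj.1 h2 h4
  · rintro ⟨z, hz, hzj, hzk⟩
    have hk : IsExtremeChild i k s (storedVertex s (3, i, k)) :=
      storedVertex_spec (x := (3, i, k)) (IsExtremeChild.exists k hz)
    have hj : IsExtremeChild i j s (storedVertex s (3, i, j)) :=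
      storedVertex_spec (x := (3, i, j)) (IsExtremeChild.exists j hz)
    refine ⟨⟨(h.cone_iff.1 hk.1.1).1, ?_⟩, (h.cone_iff.1 hj.1.1).2, ?_⟩
    · refine le_trans (le_of_not_gt fun hlt => ?_) hzj
      exact absurd (h.swap.sibling_anti hP hz hk.1 hlt) (not_lt.2 (hk.2 z hz))
    · refine le_trans (le_of_not_gt fun hlt => ?_) hzk
      exact absurd (h.sibling_anti hP hz hj.1 hlt) (not_lt.2 (hj.2 z hz))

lemma dist_sibling_le (h : Distinct i j k) (hP : GeneralPosition P) {u v w : P}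
    (hv : IsParent i v u) (hw : IsParent i w u) (hlt : hex k v < hex k w) :
    dist (v : Plane) w ≤ (hex j v - hex j w) + (hex k w - hex k v) := by
  have := h.sibling_anti hP hv hw hlt
  refine (h.dist_le v w).trans_eq ?_
  rw [abs_of_pos (by linarith), abs_of_neg (by linarith)]
  ring

lemma dist_parent_le (h : Distinct i j k) {u v : P} (hv : IsParent i v u) :
    dist (v : Plane) u ≤ (hex j v - hex j u) + (hex k v - hex k u) := by
  have := h.cone_iff.1 hv.1
  refine (h.dist_le v u).trans_eq ?_
  rw [abs_of_pos (by linarith), abs_of_pos (by linarith)]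

/-- Walking from sibling to sibling. -/
lemma reaches_walk (h : Distinct i j k) (hP : GeneralPosition P) (hG : HasRoutingEdges G)
    {t u y : P} {m : Mode} {B : ℝ} (hy : IsParent i y u)
    (hstep : ∀ v : P, IsParent i v u → hex k v < hex k y → ∀ w : P, IsSibling i k v w →
      hex k w ≤ hex k y → step (storedPoint v) v t m = (storedPoint v (1, i, k), m))
    (hB : Reaches G t y m B) (x : P) : IsParent i x u → hex k x ≤ hex k y →
      Reaches G t x m (B + (hex j x - hex j y) + (hex k y - hex k x)) := by
  induction x using induction_on_value (fun x => -hex k x) with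
  | h x ih =>
    intro hx hle
    rcases eq_or_ne x y with rfl | hne
    · exact hB.mono (by linarith)
    have hlt := lt_of_le_of_ne hle (hP.hex_ne k hne)
    have hw : IsSibling i k x (storedVertex x (1, i, k)) :=
      storedVertex_spec (x := (1, i, k)) (IsSibling.exists hx hy hlt)
    obtain ⟨hwu, hxw, hm⟩ := hP.sibling_of_parent hx hw
    have hwy := hm y hy hlt
    refine (ih _ (by linarith) hwu hwy).forward (hG.2 _ _ _ _ _ h hw)
      (hstep x hx hlt _ hw hwy) ?_
    -- Both coordinates are monotone along the siblings, so the bounds telescope.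
    linarith [h.dist_sibling_le hP hx hwu hxw]

end Distinct

lemma IsClosestChild.exists {u v : P} (h : IsParent i v u) : ∃ c, IsClosestChild i u c :=
  exists_max_value (fun c : P => hex i c) ⟨v, h⟩

lemma GeneralPosition.upStep_closest (hP : GeneralPosition P) {u c : P}
    (hc : IsClosestChild i u c) : upStep (storedPoint c) c i = ((u : Plane), .decide) := by
  rw [upStep, dif_neg, storedPoint_eq (hP.stored_parent hc.1 0)]
  rintro ⟨k, -, hlt⟩
  rw [storedPoint_eq (hP.stored_closestSibling hc.1 hc 0)] at hlt
  exact lt_irrefl _ hlt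

/-- By `sibling_anti` only one direction leads towards the closest child, so the choice is forced.
-/
lemma Distinct.upStep_sibling (h : Distinct i j k) (hP : GeneralPosition P) {u c v : P}
    (hc : IsClosestChild i u c) (hv : IsParent i v u) (hlt : hex k v < hex k c) :
    upStep (storedPoint v) v i = (storedPoint v (1, i, k), .up i) := by
  have e := storedPoint_eq (hP.stored_closestSibling hv hc 0)
  have hex' : ∃ k, k ≠ i ∧ hex k v < hex k (storedPoint v (4, i, 0)) :=
    ⟨k, h.2.1.symm, by rwa [e]⟩
  rw [upStep, dif_pos hex']
  obtain ⟨h1, h2⟩ := hex'.choose_spec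
  generalize hex'.choose = l at h1 h2 ⊢
  rw [e] at h2
  rcases (h.eq_or l).resolve_left h1 with rfl | rfl
  · exact absurd h2 (not_lt.2 (h.sibling_anti hP hv hc.1 hlt).le)
  · rfl

namespace Distinct

/-- Following the edge to a parent. -/
lemma reaches_up (h : Distinct i j k) (hP : GeneralPosition P) (hG : HasRoutingEdges G)
    {t u v : P} {B B' : ℝ} (hv : IsParent i v u) (hB : Reaches G t u .decide B)
    (h1 : B + 3 * (hex j v - hex j u) + (hex k v - hex k u) ≤ B')
    (h2 : B + (hex j v - hex j u) + 3 * (hex k v - hex k u) ≤ B') :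
    Reaches G t v (.up i) B' := by
  obtain ⟨c, hc⟩ := IsClosestChild.exists hv
  have hcu : Reaches G t c (.up i) (B + ((hex j c - hex j u) + (hex k c - hex k u))) :=
    hB.forward (hG.1 _ _ _ hc).symm (hP.upStep_closest hc)
      (by linarith [h.dist_parent_le hc.1])
  have a1 := hc.2 v hv
  have a2 := h.cone_iff.1 hc.1.1
  have a3 := h.hex_sum v
  have a4 := h.hex_sum c
  -- Relative to `u` let `v` be (x, y) and `c` be (x', y'), where x' + y' ≤ x + y. The walk to `c`
  -- and the edge to `u` cost at most (x - x') + (y' - y) + (x' + y') = x - y + 2y' ≤ 3x + y; the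
  -- other case is symmetric.
  rcases le_total (hex k v) (hex k c) with hle | hle
  · refine (h.reaches_walk hP hG hc.1 (fun x hx hlt w hw _ => ?_) hcu v hv hle).mono (by linarith)
    exact h.upStep_sibling hP hc hx hlt
  · have hle' : hex j v ≤ hex j c := by
      rcases eq_or_ne v c with rfl | hne
      · exact le_rfl
      · exact (h.sibling_anti hP hc.1 hv (lt_of_le_of_ne hle (hP.hex_ne k hne.symm))).le
    refine (h.swap.reaches_walk hP hG hc.1 (fun x hx hlt w hw _ => ?_) hcu v hv hle').mono
      (by linarith)
    exact h.swap.upStep_sibling hP hc hx hlt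

/-- 0 + 1 + 2 = 0 modulo 3; this is how the mode `down i k` names the third index. -/
lemma neg_add (h : Distinct i j k) : -(i + k) = j := by
  revert i j k
  unfold Distinct
  decide

/-- Following the edge to the child `y` with the largest coordinate not beyond `t`. -/
lemma reaches_down (h : Distinct i j k) (hP : GeneralPosition P) (hG : HasRoutingEdges G)
    {t u y c : P} {B : ℝ} (hy : IsParent i y u) (hyt : hex k y ≤ hex k t)
    (hm : ∀ x : P, IsParent i x u → hex k x ≤ hex k t → hex k x ≤ hex k y)
    (hB : Reaches G t y .decide B) (hc : IsParent i c u) :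
    Reaches G t c (.down i k) (B + |hex j c - hex j y| + |hex k y - hex k c|) := by
  -- The walk stops at `y` by itself: its next sibling in the direction `k` is missing or beyond
  -- `t`.
  have hB' : Reaches G t y (.down i k) B := by
    refine hB.congr_mode ?_
    simp only [step]
    rw [if_neg (not_lt.2 hyt), if_neg]
    rintro ⟨h1, h2⟩
    by_cases hw : ∃ w, slotRel (1, i, k) y w
    · have hw : IsSibling i k y (storedVertex y (1, i, k)) := storedVertex_spec hw
      have := hm _ (hP.sibling_of_parent hy hw).1 h2
      exact absurd h1 (not_lt.2 this)
    · rw [storedPoint, storedVertex_eq hw] at h1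
      exact lt_irrefl _ h1
  rcases le_total (hex k c) (hex k y) with hle | hle
  · refine (h.reaches_walk hP hG hy (fun x hx hlt w hw hwy => ?_) hB' c hc hle).mono
      (by linarith [le_abs_self (hex j c - hex j y), le_abs_self (hex k y - hex k c)])
    have hw : IsSibling i k x (storedVertex x (1, i, k)) :=
      storedVertex_spec (x := (1, i, k)) ⟨w, hw⟩
    obtain ⟨-, hxw, hm'⟩ := hP.sibling_of_parent hx hw
    simp only [step]
    rw [if_neg (by linarith), if_pos ⟨hxw, (hm' y hy hlt).trans hyt⟩]
  -- Every sibling beyond `y` is beyond `t`, so the message turns back.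
  · have hle' : hex j c ≤ hex j y := by
      rcases eq_or_ne y c with rfl | hne
      · exact le_rfl
      · exact (h.sibling_anti hP hy hc (lt_of_le_of_ne hle (hP.hex_ne k hne))).le
    refine (h.swap.reaches_walk hP hG hy (fun x hx hlt w hw hwy => ?_) hB' c hc hle').mono
      (by linarith [neg_abs_le (hex j c - hex j y), neg_abs_le (hex k y - hex k c)])
    have hlt' := h.swap.sibling_anti hP hx hy hlt
    simp only [step]
    rw [if_pos (by
      by_contra hcon
      exact absurd (hm x hx (not_lt.1 hcon)) (not_le.2 hlt')), h.neg_add]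

/-- Following the edge from a vertex to a child. -/
lemma reaches_child (h : Distinct i j k) (hP : GeneralPosition P) (hG : HasRoutingEdges G)
    {t u y : P} {B B' : ℝ} (hy : IsParent i y u) (hyt : hex k y ≤ hex k t)
    (hm : ∀ x : P, IsParent i x u → hex k x ≤ hex k t → hex k x ≤ hex k y)
    (hB : Reaches G t y .decide B)
    (hs : decideStep (storedPoint u) u t = (storedPoint u (2, i, 0), .down i k))
    (h1 : B + 3 * (hex j y - hex j u) + (hex k y - hex k u) ≤ B')
    (h2 : B + (hex j y - hex j u) + 3 * (hex k y - hex k u) ≤ B') :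
    Reaches G t u .decide B' := by
  obtain ⟨c, hc⟩ := IsClosestChild.exists hy
  have e := storedPoint_eq (hP.stored_closestChild hc 0)
  have a0 := h.dist_parent_le hc.1
  have a1 := hc.2 y hy
  have a2 := h.cone_iff.1 hc.1.1
  have a3 := h.hex_sum y
  have a4 := h.hex_sum c
  refine (h.reaches_down hP hG hy hyt hm hB hc.1).forward (hG.1 _ _ _ hc)
    (by rw [← e]; exact hs) ?_
  rw [dist_comm]
  rcases lt_trichotomy (hex k c) (hex k y) with hlt | heq | hlt
  · have := h.sibling_anti hP hc.1 hy hlt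
    rw [abs_of_pos (by linarith), abs_of_pos (by linarith)]
    linarith
  · have : c = y := by
      by_contra hne
      exact hP.hex_ne k hne heq
    subst this
    simp only [sub_self, abs_zero]
    linarith
  · have := h.sibling_anti hP hy hc.1 hlt
    rw [abs_of_neg (by linarith), abs_of_neg (by linarith)]
    linarith

/-- Routing to a destination in a negative cone. -/
lemma reaches_neg (h : Distinct i j k) (hP : GeneralPosition P) (hG : HasRoutingEdges G)
    {t : P} (s : P) : Cone i t s → ∀ j k, Distinct i j k →
      Reaches G t s .decide (3 * (2 * (hex i s - hex i t) + (hex j t - hex j s))) ∧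
      (¬ SideOccupied k s t →
        Reaches G t s .decide (3 * (hex i s - hex i t + (hex j t - hex j s)))) := by
  induction s using induction_on_value (fun s => hex i s) with
  | h s ih =>
  intro ht
  obtain ⟨j, k, d, hpref, hstep⟩ := h.exists_decideStep_neg (I := storedPoint s) ht
  rw [Prefers, seesOccupied_iff, seesOccupied_iff] at hpref
  have hst := d.cone_iff.1 ht
  have ss := d.hex_sum s
  have st := d.hex_sum t
  -- With `j` the preferred side, `b` bounds 2p + q, and also 3p + 2q if the side `k` is occupied. A
  -- step to a child at differences (x, y) lowers these by 2x + y and 3x + 2y, enough for its cost.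
  have key : ∀ b, hex i s - hex i t + (hex j t - hex j s) ≤ b →
      (SideOccupied k s t → 2 * (hex i s - hex i t) + (hex j t - hex j s) ≤ b) →
      Reaches G t s .decide (3 * b) := by
    intro b hb1 hb2
    by_cases hch : ∃ z : P, IsParent i z s ∧ hex j z ≤ hex j t ∧ hex k z ≤ hex k t
    · rw [negStep, if_pos ((d.seesChild_iff hP ht).2 hch)] at hstep
      obtain ⟨z, hz, hzj, hzk⟩ := hch
      -- The last child not beyond `t` is needed to keep a free side `k` free.
      obtain ⟨y, ⟨hy, hyk⟩, hm⟩ := exists_max_value (fun y : P => hex k y)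
        (p := fun y => IsParent i y s ∧ hex k y ≤ hex k t) ⟨z, hz, hzk⟩
      have hm' : ∀ x : P, IsParent i x s → hex k x ≤ hex k t → hex k x ≤ hex k y :=
        fun x hx hxt => hm x ⟨hx, hxt⟩
      have hyj : hex j y ≤ hex j t := by
        refine le_trans (le_of_not_gt fun hlt => ?_) hzj
        exact absurd (d.swap.sibling_anti hP hz hy hlt) (not_lt.2 (hm' z hz hzk))
      have hys := d.cone_iff.1 hy.1
      have sy := d.hex_sum y
      rcases eq_or_ne y t with rfl | hne
      · exact d.reaches_child hP hG hy hyk hm' (Reaches.refl y _ le_rfl) hstep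
          (by linarith) (by linarith)
      have hyt : Cone i t y := d.cone_iff.2
        ⟨lt_of_le_of_ne hyj (hP.hex_ne j hne), lt_of_le_of_ne hyk (hP.hex_ne k hne)⟩
      obtain ⟨ih1, ih2⟩ := ih y (by linarith) hyt j k d
      by_cases hk : SideOccupied k s t
      · exact d.reaches_child hP hG hy hyk hm' ih1 hstep
          (by linarith [hb2 hk]) (by linarith [hb2 hk])
      · exact d.reaches_child hP hG hy hyk hm' (ih2 (d.side_free_child hP hk hy hm')) hstep
          (by linarith) (by linarith)
    · rw [negStep, if_neg (fun h' => hch ((d.seesChild_iff hP ht).1 h'))] at hstep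
      have hocc : SideOccupied j s t := by
        by_contra hj
        have hk : ¬ SideOccupied k s t := by tauto
        exact hch (d.exists_child_of_sides_free hP ht hj hk)
      obtain ⟨z, hz, hzt⟩ := hocc
      obtain ⟨v, hv⟩ := IsParent.exists hz
      have hvt : hex j v < hex j t := (hv.2 z hz).trans_lt hzt
      have hvs := d.rotate.cone_iff.1 hv.1
      have sv := d.hex_sum v
      have htv : Cone i t v := d.cone_iff.2 ⟨hvt, by linarith⟩
      -- If the edge has differences x, y in the coordinates `i`, `k`, then p shrinks by x + y and q
      -- grows by y. The potentials drop by 2x + y or 3x + y, and three times this covers 3x + y and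
      -- x + 3y.
      obtain ⟨ih1, ih2⟩ := ih v (by linarith) htv j k d
      have hcongr : ∀ {b}, Reaches G t s (.up j) b → Reaches G t s .decide b :=
        fun hr => hr.congr_mode hstep
      by_cases hk : SideOccupied k s t
      · exact hcongr (d.rotate.reaches_up hP hG hv ih1
          (by linarith [hb2 hk]) (by linarith [hb2 hk]))
      · exact hcongr (d.rotate.reaches_up hP hG hv (ih2 (d.side_free_parent hP hk hv hvt hch))
          (by linarith) (by linarith))
  -- The bounds for the opposite order follow by preference: if `k` is occupied, so is `j`, and p ≤
  -- q; if `j` is free, so is `k`, and p ≤ q.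
  intro j' k' d'
  have hcases : (j' = j ∧ k' = k) ∨ (j' = k ∧ k' = j) := by
    rcases (d.eq_or j').resolve_left d'.1.symm with rfl | rfl <;>
    rcases (d.eq_or k').resolve_left d'.2.1.symm with rfl | rfl
    · exact absurd rfl d'.2.2
    · exact .inl ⟨rfl, rfl⟩
    · exact .inr ⟨rfl, rfl⟩
    · exact absurd rfl d'.2.2
  rcases hcases with ⟨rfl, rfl⟩ | ⟨rfl, rfl⟩
  · exact ⟨key _ (by linarith) (fun _ => le_rfl), fun hk => key _ le_rfl (fun hk' => absurd hk' hk)⟩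
  · refine ⟨key _ (by linarith) (fun hk => ?_), fun hj => ?_⟩
    · rcases hpref with hp | hp
      · exact absurd hk hp.2
      · linarith [hp.2]
    · have hp := (hpref.resolve_left (fun hp => hj hp.1))
      exact key _ (by linarith [hp.2]) (fun hk => absurd (hp.1.2 hk) hj)

end Distinct

/-! ### Destinations in a positive cone -/

lemma GeneralPosition.exists_cone (hP : GeneralPosition P) {s t : P} (h : s ≠ t) :
    (∃ i, Cone i s t) ∨ ∃ i, Cone i t s := by
  have d0 := distinct_add 0
  have d1 := distinct_add 1
  have d2 := distinct_add 2
  have h0 := hP.hex_ne 0 h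
  have h1 := hP.hex_ne 1 h
  have h2 := hP.hex_ne 2 h
  have ss := hex_sum s
  have st := hex_sum t
  rcases lt_or_gt_of_ne h0 with a | a <;> rcases lt_or_gt_of_ne h1 with b | b <;>
    rcases lt_or_gt_of_ne h2 with c | c
  · linarith
  · exact .inr ⟨2, d2.cone_iff.2 ⟨a, b⟩⟩
  · exact .inr ⟨1, d1.cone_iff.2 ⟨c, a⟩⟩
  · exact .inl ⟨0, d0.cone_iff.2 ⟨b, c⟩⟩
  · exact .inr ⟨0, d0.cone_iff.2 ⟨b, c⟩⟩
  · exact .inl ⟨1, d1.cone_iff.2 ⟨c, a⟩⟩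
  · exact .inl ⟨2, d2.cone_iff.2 ⟨a, b⟩⟩
  · linarith

/-- Routing to a destination in a positive cone. -/
lemma Distinct.reaches_pos (h : Distinct i j k) (hP : GeneralPosition P) (hG : HasRoutingEdges G)
    {t : P} (s : P) : Cone i s t → ∀ b, hex i t - hex i s + (hex j s - hex j t) ≤ b →
      hex i t - hex i s + (hex k s - hex k t) ≤ b → Reaches G t s .decide (3 * b) := by
  induction s using induction_on_value (fun s => -hex i s) with
  | h s ih =>
  intro ht b hbj hbk
  have hst := h.cone_iff.1 ht
  obtain ⟨v, hv⟩ := IsParent.exists ht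
  have hvs := h.cone_iff.1 hv.1
  have ss := h.hex_sum s
  have st := h.hex_sum t
  have sv := h.hex_sum v
  have hvt := hv.2 t ht
  have hcongr : ∀ {b}, Reaches G t s (.up i) b → Reaches G t s .decide b :=
    fun hr => hr.congr_mode (decideStep_pos ht)
  rcases eq_or_ne v t with rfl | hne
  · exact hcongr (h.reaches_up hP hG hv (Reaches.refl v _ le_rfl) (by linarith) (by linarith))
  have hvt' := lt_of_le_of_ne hvt (hP.hex_ne i hne)
  rcases hP.exists_cone hne with ⟨l, hl⟩ | ⟨l, hl⟩ <;> rcases h.eq_or l with rfl | rfl | rfl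
  -- With edge differences x, y both lower bounds on `b` drop by at least x + y + min(x, y), and
  -- three times this covers the cost.
  · have hl' := h.cone_iff.1 hl
    exact hcongr (h.reaches_up hP hG hv (ih v (by linarith) hl
      (b - (hex l v - hex l s) - min (hex j s - hex j v) (hex k s - hex k v))
      (by linarith [min_le_left (hex j s - hex j v) (hex k s - hex k v)])
      (by linarith [min_le_right (hex j s - hex j v) (hex k s - hex k v)]))
      (by rcases min_choice (hex j s - hex j v) (hex k s - hex k v) with e | e <;> rw [e] <;>
            linarith)
      (by rcases min_choice (hex j s - hex j v) (hex k s - hex k v) with e | e <;> rw [e] <;>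
            linarith))
  · linarith [h.rotate.cone_iff.1 hl]
  · linarith [h.rotate.rotate.cone_iff.1 hl]
  · linarith [h.cone_iff.1 hl]
  -- Now `t` lies in a negative cone of `v` with one side free, so the smaller bound applies.
  · have hl' := h.rotate.cone_iff.1 hl
    have hr := (h.rotate.reaches_neg hP hG v hl i k h.rotate.swap).2
      (h.side_free_positive ht hv)
    exact hcongr (h.reaches_up hP hG hv hr (by linarith) (by linarith))
  · have hl' := h.rotate.rotate.cone_iff.1 hl
    have hr := (h.rotate.rotate.reaches_neg hP hG v hl i j h.rotate.rotate).2
      (h.swap.side_free_positive ht hv)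
    exact hcongr (h.reaches_up hP hG hv hr (by linarith) (by linarith))

end

theorem mainTheorem9 :
    ∃ (m : ℕ) (A : RoutingAlgorithm), ∀ P : Finset Plane, GeneralPosition P →
      ∃ info : P → List MemCell, (∀ v, FitsMemory P m (info v)) ∧
        ∀ G : SimpleGraph P, G = G9 P ∨ G = G12 P →
          A.IsCompetitive G 1 m info InPosCone 6 ∧
          A.IsCompetitive G 1 m info InNegCone (3 * (5 / Real.sqrt 3)) := by
  refine ⟨45, router, fun P hP => ⟨fun v => encodeInfo (storedPoint v), fitsMemory_encodeInfo,
    fun G hG => ⟨?_, ?_⟩⟩⟩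
  · rintro s t ⟨i, hi⟩
    rw [mem_posCone_iff] at hi
    have d := distinct_add i
    have hst := d.cone_iff.1 hi
    have ss := d.hex_sum s
    have st := d.hex_sum t
    have hd := d.dist_sq s t
    have h0 : 0 ≤ dist (s : Plane) t := dist_nonneg
    -- 2p + q and p + 2q are at most 2|st|, since |st|² = p² + pq + q².
    have hr := d.reaches_pos hP (hP.hasRoutingEdges hG) s hi (2 * dist (s : Plane) t)
      (by nlinarith) (by nlinarith)
    obtain ⟨L, hL, hr⟩ := hr
    exact ⟨L, hr, by linarith⟩
  · rintro s t ⟨i, hi⟩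
    rw [mem_negCone_iff] at hi
    have d := distinct_add i
    have hst := d.cone_iff.1 hi
    have ss := d.hex_sum s
    have st := d.hex_sum t
    have hd := d.dist_sq s t
    have h0 : 0 ≤ dist (s : Plane) t := dist_nonneg
    have e : 3 * (5 / √3) * dist (s : Plane) t = 5 * √3 * dist (s : Plane) t := by
      rw [div_eq_mul_inv, inv_sqrt_three]; ring
    rw [e]
    have hi' : hex i s - hex i t =
        (hex (i + 1) t - hex (i + 1) s) + (hex (i + 2) t - hex (i + 2) s) := by linarith
    have h3 := sqrt_three_pos
    have h3' := sqrt_three_sq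
    -- With p ≤ q the length is at most 3(3p + 2q); its ratio to |st| is largest for p = q, where it
    -- is 5√3.
    rcases le_total (hex (i + 1) t - hex (i + 1) s) (hex (i + 2) t - hex (i + 2) s) with hle | hle
    · obtain ⟨L, hL, hr⟩ := (d.reaches_neg hP (hP.hasRoutingEdges hG) s hi _ _ d).1
      refine ⟨L, hr, hL.trans (abs_le_of_sq_le_sq' ?_ (by positivity)).2⟩
      rw [mul_pow, mul_pow, mul_pow, hd, sq √3, h3', hi']
      nlinarith [mul_nonneg (sub_nonneg.2 hle) (sub_pos.2 hst.1).le,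
        mul_nonneg (sub_nonneg.2 hle) (sub_pos.2 hst.2).le]
    · obtain ⟨L, hL, hr⟩ := (d.reaches_neg hP (hP.hasRoutingEdges hG) s hi _ _ d.swap).1
      refine ⟨L, hr, hL.trans (abs_le_of_sq_le_sq' ?_ (by positivity)).2⟩
      rw [mul_pow, mul_pow, mul_pow, hd, sq √3, h3', hi']
      nlinarith [mul_nonneg (sub_nonneg.2 hle) (sub_pos.2 hst.2).le,
        mul_nonneg (sub_nonneg.2 hle) (sub_pos.2 hst.1).le]
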